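/- Let $(m_i)_{i\ge 1}$ be a strictly increasing sequence of positive integers with $m_1=1$. For positive integers $j,j'$ write $j'\prec j$ if $j'<m_k\le j$ for some $k\ge 1$, and let $$\mathcal S_{\vec m}=\langle x,y \mid x^2=x,\ \ xy^jxy^{j'}x=xy^jx \text{ for all } j,j'\ge 1 \text{ with } j'\prec j\rangle$$ be the semigroup with identity given by this presentation. Let $|a|$ denote the least $k\ge 0$ such that $a\in\mathcal S_{\vec m}$ is a product of $k$ elements of $\{x,y\}$. Let $R_n=X_1\cdots X_n$, where $X_1,X_2,\dots$ are independent and uniformly distributed on $\{x,y\}$, be the simple random walk on $\mathcal S_{\vec m}$. Put $$\gamma_{\vec m}(n)=\sum_{k\ge 1:\ m_{k+1}\le \log_2 n} m_k\,2^{m_{k+1}-m_k}.$$ For all real $\beta\ge 1$ and $\delta>0$ there are constants $C_1,C_2>0$, depending only on $\beta$ and $\delta$, such that for every such sequence with $m_i\le \beta m_{i-1}+\delta$ for all $i>1$ and for every integer $n\ge 2$ the expectation $\mathbb E|R_n|$ is finite and $$C_1\,\gamma_{\vec m}(n)\ \le\ \mathbb E|R_n|\ \le\ C_2\left(\gamma_{\vec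 m}(n)+n^{\frac{\beta-1}{\beta}}\log_2 n\right).$$ -/

import Mathlib

open MeasureTheory ProbabilityTheory

namespace SemigroupSpeed

/-- The two letters of the alphabet. -/
inductive Letter : Type
  | x : Letter
  | y : Letter

/-- Sequences are indexed from `0` in the code: `m i` is the term written `m_{i+1}` on paper, so
that the first term is `m 0`.

`Prec m j' j` is the relation `j' ≺ j`: some term `m_k` satisfies `j' < m_k ≤ j`. -/
def Prec (m : ℕ → ℕ) (j' j : ℕ) : Prop :=
  ∃ k, j' < m k ∧ m k ≤ j

/-- The letter `x` as an element of the free monoid. -/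
def wx : FreeMonoid Letter := FreeMonoid.of Letter.x

/-- The letter `y` as an element of the free monoid. -/
def wy : FreeMonoid Letter := FreeMonoid.of Letter.y

/-- The defining relations: `x² = x`, and `x y^j x y^{j'} x = x y^j x` for all `j, j' ≥ 1` with
`j' ≺ j`. -/
inductive Rel (m : ℕ → ℕ) : FreeMonoid Letter → FreeMonoid Letter → Prop
  | idem : Rel m (wx * wx) wx
  | absorb (j j' : ℕ) (hj : 1 ≤ j) (hj' : 1 ≤ j') (h : Prec m j' j) :
      Rel m (wx * wy ^ j * wx * wy ^ j' * wx) (wx * wy ^ j * wx)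

/-- The semigroup (with identity) generated by `x, y` subject to the relations `Rel m`. -/
abbrev S (m : ℕ → ℕ) : Type := PresentedMonoid (Rel m)

/-- The discrete σ-algebra on the (countable) semigroup. -/
instance instMeasurableSpaceS (m : ℕ → ℕ) : MeasurableSpace (S m) := ⊤

/-- The generating set `{x, y}`. -/
def gens (m : ℕ → ℕ) : Set (S m) :=
  {PresentedMonoid.of (Rel m) Letter.x, PresentedMonoid.of (Rel m) Letter.y}

/-- Word length with respect to `T`: the least `k ≥ 0` such that `a = t₁ ⋯ t_k` for some
`t₁, …, t_k ∈ T`, that is, the distance from `1` to `a` in the Cayley graph. -/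
noncomputable def wordLength {M : Type*} [Monoid M] (T : Set M) (a : M) : ℕ :=
  sInf {k | ∃ l : List M, l.length = k ∧ (∀ t ∈ l, t ∈ T) ∧ l.prod = a}

/-- `R` is a simple random walk on the monoid `M` with respect to the finite set `T`:
`R_n = X_1 ⋯ X_n` (so `R_0 = 1`) with `X_1, X_2, …` independent and uniformly distributed on `T`.
In the code the steps are indexed from `0`. -/
def IsSimpleRandomWalk {M : Type*} [Monoid M] [MeasurableSpace M] (T : Set M)
    {Ω : Type*} [MeasurableSpace Ω] (P : Measure Ω) (R : ℕ → Ω → M) : Prop :=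
  ∃ X : ℕ → Ω → M,
    (∀ i, Measurable (X i)) ∧ iIndepFun X P ∧ (∀ i, P.map (X i) = uniformOn T) ∧
    (∀ ω, R 0 ω = 1) ∧ (∀ n ω, R (n + 1) ω = R n ω * X n ω)

/-- `γ_m(n)`, the sum of `m_k 2^{m_{k+1} - m_k}` over all `k` with `m_{k+1} ≤ log₂ n`. For strictly
increasing `m` this index set is finite (`finite_gamma_index`). -/
noncomputable def gamma (m : ℕ → ℕ) (n : ℕ) : ℝ :=
  ∑ᶠ (k : ℕ) (_ : (m (k + 1) : ℝ) ≤ Real.logb 2 n),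
    (m k : ℝ) * (2 : ℝ) ^ ((m (k + 1) : ℤ) - (m k : ℤ))

theorem finite_gamma_index {m : ℕ → ℕ} (hm : StrictMono m) (n : ℕ) :
    {k : ℕ | (m (k + 1) : ℝ) ≤ Real.logb 2 n}.Finite := by
  refine (Set.finite_Iic ⌊Real.logb 2 n⌋₊).subset fun k hk => ?_
  have h1 : m (k + 1) ≤ ⌊Real.logb 2 n⌋₊ := Nat.le_floor hk
  have h2 : k + 1 ≤ m (k + 1) := hm.id_le (k + 1)
  exact Set.mem_Iic.2 (by omega)

end SemigroupSpeed

namespace SemigroupSpeed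

/-! Read a word from left to right. A gap `y^j` between two letters `x` is dropped when `j = 0` or
when some `m k` separates `j` from the longest gap seen so far, so a triple of numbers (`State`)
records all that matters. Both relations respect this bookkeeping, and a letter raises the reduced
length by at most one. Hence the reduced length is the word length (`wordLength_eq`), and the
expectation is an average over uniformly random words.

In that average a gap of length `j` has weight of order `j 2^(-j)` times the expected number of
moments at which it would be kept. For `m k ≤ j < m (k+1)` it is kept as long as `x y^(m (k+1))` has
not occurred (`keepProb_eq_avoid`), and the waiting time for that pattern is of order `2^(m (k+1))`
(`sum_avoid_le`, `le_sum_avoid`). The weights in the block sum to order `m k 2^(-m k)`, already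
reached by the first one, so the block yields the `k`-th term of `gamma`.

Let `N` be the first index with `m (N+1) > log₂ n`. Gaps of length at least `m N` contribute at most
order `n m_N 2^(-m_N)`, and `log₂ n < β m_N + δ` turns this into the error term (`tail_le`). -/

theorem Prec.lt {m : ℕ → ℕ} {j' j : ℕ} (h : Prec m j' j) : j' < j := by
  obtain ⟨k, h1, h2⟩ := h
  omega

theorem Prec.mono_right {m : ℕ → ℕ} {i j k : ℕ} (h : Prec m i j) (hjk : j ≤ k) : Prec m i k := by
  obtain ⟨l, h1, h2⟩ := h
  exact ⟨l, h1, h2.trans hjk⟩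

/-! ### Left-to-right reduction of words -/

/-- The state of the left-to-right reduction of a word: the length of the reduced word up to its
last `x` (`0` if there is no `x` yet), the longest `y`-run between two letters `x` seen so far, and
the length of the current `y`-run. -/
@[ext] structure State where
  committed : ℕ
  maxGap : ℕ
  run : ℕ

namespace State

/-- The state of the empty word. -/
def init : State := ⟨0, 0, 0⟩

open Classical in
/-- Reading the letter `x`. -/
noncomputable def stepX (m : ℕ → ℕ) (σ : State) : State where
  committed := if σ.committed = 0 ∨ (σ.run ≠ 0 ∧ ¬ Prec m σ.run σ.maxGap)
    then σ.committed + (σ.run + 1) else σ.committed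
  maxGap := if σ.committed = 0 then σ.maxGap else max σ.maxGap σ.run
  run := 0

/-- Reading the letter `y`. -/
def stepY (σ : State) : State := ⟨σ.committed, σ.maxGap, σ.run + 1⟩

/-- The length of the reduced word. -/
def length (σ : State) : ℕ := σ.committed + σ.run

theorem stepY_iterate (j : ℕ) (σ : State) :
    stepY^[j] σ = ⟨σ.committed, σ.maxGap, σ.run + j⟩ := by
  induction j with
  | zero => rfl
  | succ j ih => rw [Function.iterate_succ_apply', ih]; rfl

theorem stepX_run (m : ℕ → ℕ) (σ : State) : (stepX m σ).run = 0 := rfl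

theorem maxGap_stepX {m : ℕ → ℕ} {σ : State} (h : σ.committed ≠ 0) :
    (stepX m σ).maxGap = max σ.maxGap σ.run := if_neg h

theorem stepX_committed_ne_zero (m : ℕ → ℕ) (σ : State) : (stepX m σ).committed ≠ 0 := by
  simp only [stepX]
  split_ifs with h
  · omega
  · tauto

theorem stepX_of_fixed {m : ℕ → ℕ} {σ : State} (h0 : σ.committed ≠ 0)
    (h : σ.run = 0 ∨ Prec m σ.run σ.maxGap) : stepX m σ = ⟨σ.committed, σ.maxGap, 0⟩ := by
  have h1 : σ.run ≤ σ.maxGap := by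
    rcases h with h | h
    · omega
    · exact h.lt.le
  ext
  · simp only [stepX]
    rw [if_neg (by tauto)]
  · simp only [stepX]
    rw [if_neg h0, max_eq_left h1]
  · rfl

theorem stepX_stepX (m : ℕ → ℕ) (σ : State) : stepX m (stepX m σ) = stepX m σ :=
  stepX_of_fixed (stepX_committed_ne_zero m σ) (Or.inl rfl)

/-- After `x y^j x` the longest gap is at least `j`, so it absorbs whatever `j` absorbs. -/
theorem stepX_absorb {m : ℕ → ℕ} {j j' : ℕ} (h : Prec m j' j) (σ : State) :
    stepX m (stepY^[j'] (stepX m (stepY^[j] (stepX m σ)))) =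
      stepX m (stepY^[j] (stepX m σ)) := by
  set τ := stepX m (stepY^[j] (stepX m σ)) with hτ
  have hj : j ≤ τ.maxGap := by
    rw [hτ, stepY_iterate, maxGap_stepX (by exact stepX_committed_ne_zero m σ)]
    simp [stepX_run]
  have hr : τ.run = 0 := rfl
  rw [stepY_iterate, stepX_of_fixed]
  · ext <;> simp [hr]
  · exact stepX_committed_ne_zero m _
  · right
    simpa [hr] using h.mono_right hj

/-- The action of a letter on states. -/
noncomputable def step (m : ℕ → ℕ) : Letter → State → State
  | Letter.x => stepX m
  | Letter.y => stepY

theorem length_step_le (m : ℕ → ℕ) (l : Letter) (σ : State) :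
    (step m l σ).length ≤ σ.length + 1 := by
  cases l
  · simp only [step, length, stepX]
    split_ifs <;> omega
  · simp only [step, length, stepY]
    omega

end State

open State

/-! ### Action of the semigroup on states -/

/-- The right action of the free monoid on states. -/
noncomputable def freeAction (m : ℕ → ℕ) : FreeMonoid Letter →* (Function.End State)ᵐᵒᵖ :=
  FreeMonoid.lift fun l => MulOpposite.op (step m l)

theorem freeAction_wy_pow (m : ℕ → ℕ) (j : ℕ) :
    (freeAction m (wy ^ j)).unop = stepY^[j] := by
  rw [map_pow, MulOpposite.unop_pow]
  induction j with
  | zero => rfl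
  | succ j ih =>
    rw [pow_succ, ih, Function.iterate_succ]
    rfl

theorem freeAction_wx (m : ℕ → ℕ) : (freeAction m wx).unop = stepX m := rfl

theorem freeAction_mul_apply (m : ℕ → ℕ) (a b : FreeMonoid Letter) (σ : State) :
    (freeAction m (a * b)).unop σ = (freeAction m b).unop ((freeAction m a).unop σ) := by
  rw [map_mul]
  rfl

theorem freeAction_rel {m : ℕ → ℕ} {a b : FreeMonoid Letter} (h : Rel m a b) :
    freeAction m a = freeAction m b := by
  apply MulOpposite.unop_injective
  funext σ
  cases h with
  | idem => simpa only [freeAction_mul_apply, freeAction_wx] using stepX_stepX m σ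
  | absorb j j' hj hj' h =>
    simpa only [freeAction_mul_apply, freeAction_wx, freeAction_wy_pow] using stepX_absorb h σ

/-- The right action of the semigroup on states. -/
noncomputable def action (m : ℕ → ℕ) : S m →* (Function.End State)ᵐᵒᵖ :=
  PresentedMonoid.lift (M := (Function.End State)ᵐᵒᵖ) (fun l => MulOpposite.op (step m l))
    fun _ _ h => freeAction_rel h

/-- The state of an element of the semigroup. -/
noncomputable def state {m : ℕ → ℕ} (a : S m) : State := (action m a).unop init

theorem state_one (m : ℕ → ℕ) : state (1 : S m) = init := by
  rw [state, map_one]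
  rfl

theorem state_mul_of {m : ℕ → ℕ} (a : S m) (l : Letter) :
    state (a * PresentedMonoid.of (Rel m) l) = step m l (state a) := by
  rw [state, map_mul]
  rfl

theorem of_x_ne_of_y (m : ℕ → ℕ) :
    PresentedMonoid.of (Rel m) Letter.x ≠ PresentedMonoid.of (Rel m) Letter.y := by
  intro h
  have h1 := state_mul_of (1 : S m) Letter.x
  have h2 := state_mul_of (1 : S m) Letter.y
  rw [h, h2] at h1
  have h3 := congrArg State.run h1
  simp [step, stepX, stepY] at h3

theorem of_x_mul_self (m : ℕ → ℕ) :
    PresentedMonoid.of (Rel m) Letter.x * PresentedMonoid.of (Rel m) Letter.x =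
      PresentedMonoid.of (Rel m) Letter.x :=
  PresentedMonoid.mk_eq_mk_of_rel Rel.idem

theorem of_absorb {m : ℕ → ℕ} {j j' : ℕ} (hj : 1 ≤ j) (hj' : 1 ≤ j') (h : Prec m j' j) :
    PresentedMonoid.of (Rel m) Letter.x * PresentedMonoid.of (Rel m) Letter.y ^ j *
        PresentedMonoid.of (Rel m) Letter.x * PresentedMonoid.of (Rel m) Letter.y ^ j' *
        PresentedMonoid.of (Rel m) Letter.x =
      PresentedMonoid.of (Rel m) Letter.x * PresentedMonoid.of (Rel m) Letter.y ^ j *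
        PresentedMonoid.of (Rel m) Letter.x :=
  PresentedMonoid.mk_eq_mk_of_rel (Rel.absorb j j' hj hj' h)

/-! ### Word length as reduced length -/

/-- `a` is a product of `k` elements of `T`. -/
def IsProdOf {M : Type*} [Monoid M] (T : Set M) (k : ℕ) (a : M) : Prop :=
  ∃ l : List M, l.length = k ∧ (∀ t ∈ l, t ∈ T) ∧ l.prod = a

theorem IsProdOf.mul_mem {M : Type*} [Monoid M] {T : Set M} {k : ℕ} {a t : M}
    (h : IsProdOf T k a) (ht : t ∈ T) : IsProdOf T (k + 1) (a * t) := by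
  obtain ⟨l, h1, h2, h3⟩ := h
  refine ⟨l ++ [t], by simp [h1], ?_, by simp [h3]⟩
  intro s hs
  rcases List.mem_append.1 hs with hs | hs
  · exact h2 s hs
  · rw [List.mem_singleton.1 hs]
    exact ht

theorem IsProdOf.mul_pow {M : Type*} [Monoid M] {T : Set M} {k : ℕ} {a t : M}
    (h : IsProdOf T k a) (ht : t ∈ T) (r : ℕ) : IsProdOf T (k + r) (a * t ^ r) := by
  induction r with
  | zero => simpa using h
  | succ r ih =>
    rw [pow_succ, ← mul_assoc, ← Nat.add_assoc]
    exact ih.mul_mem ht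

theorem x_mem_gens (m : ℕ → ℕ) : PresentedMonoid.of (Rel m) Letter.x ∈ gens m := Or.inl rfl

theorem y_mem_gens (m : ℕ → ℕ) : PresentedMonoid.of (Rel m) Letter.y ∈ gens m := Or.inr rfl

/-- `c` is a reduced element that ends in `x`, or is `1`, and has the given state data. -/
structure IsCommitted {m : ℕ → ℕ} (c : S m) (σ : State) : Prop where
  isProdOf : IsProdOf (gens m) σ.committed c
  eq_mul_x : σ.committed ≠ 0 → ∃ z, c = z * PresentedMonoid.of (Rel m) Letter.x
  maxGap_eq_zero : σ.committed = 0 → σ.maxGap = 0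
  eq_gap : σ.maxGap ≠ 0 → ∃ z j, 1 ≤ j ∧
    c = z * (PresentedMonoid.of (Rel m) Letter.x * PresentedMonoid.of (Rel m) Letter.y ^ j *
      PresentedMonoid.of (Rel m) Letter.x) ∧
    ∀ i, Prec m i σ.maxGap → Prec m i j

/-- The relations let a gap be absorbed only by the gap just before it, while states compare it with
the longest gap. The two agree: when a gap is kept, no `m k` lies above it and at or below the
previous maximum, so the last kept gap absorbs as much as the longest one. -/
theorem IsCommitted.stepX {m : ℕ → ℕ} {c : S m} {σ : State} (h : IsCommitted c σ) :
    ∃ c' : S m, IsCommitted c' (stepX m σ) ∧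
      c' = c * PresentedMonoid.of (Rel m) Letter.y ^ σ.run *
        PresentedMonoid.of (Rel m) Letter.x := by
  refine ⟨_, ?_, rfl⟩
  have hprod : IsProdOf (gens m) (σ.committed + (σ.run + 1))
      (c * PresentedMonoid.of (Rel m) Letter.y ^ σ.run *
        PresentedMonoid.of (Rel m) Letter.x) :=
    (h.isProdOf.mul_pow (y_mem_gens m) σ.run).mul_mem (x_mem_gens m)
  by_cases h0 : σ.committed = 0
  · refine ⟨?_, fun _ => ⟨_, rfl⟩, fun h' => absurd h' (stepX_committed_ne_zero m σ), ?_⟩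
    · simpa [State.stepX, h0] using hprod
    · intro h'
      exact absurd (by simp [State.stepX, h0, h.maxGap_eq_zero h0]) h'
  by_cases hfix : σ.run = 0 ∨ Prec m σ.run σ.maxGap
  · have hc : c * PresentedMonoid.of (Rel m) Letter.y ^ σ.run *
        PresentedMonoid.of (Rel m) Letter.x = c := by
      by_cases hr : σ.run = 0
      · obtain ⟨z, hz⟩ := h.eq_mul_x h0
        rw [hr, pow_zero, mul_one, hz, mul_assoc, of_x_mul_self]
      · have hp := hfix.resolve_left hr
        obtain ⟨z, j, hj, hz, hi⟩ := h.eq_gap (by have := hp.lt; omega)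
        rw [hz, mul_assoc z, mul_assoc z, of_absorb hj (by omega) (hi _ hp)]
    rw [hc, stepX_of_fixed h0 hfix]
    exact ⟨h.isProdOf, h.eq_mul_x, h.maxGap_eq_zero, h.eq_gap⟩
  · obtain ⟨hr, hp⟩ := not_or.1 hfix
    refine ⟨?_, fun _ => ⟨_, rfl⟩, fun h' => absurd h' (stepX_committed_ne_zero m σ), ?_⟩
    · simp only [State.stepX]
      rw [if_pos (Or.inr ⟨hr, hp⟩)]
      exact hprod
    · intro _
      obtain ⟨z, hz⟩ := h.eq_mul_x h0
      refine ⟨z, σ.run, by omega, by rw [hz]; simp only [mul_assoc], ?_⟩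
      intro i hi
      simp only [State.stepX] at hi
      rw [if_neg h0] at hi
      obtain ⟨k, hk1, hk2⟩ := hi
      rcases le_max_iff.1 hk2 with hk | hk
      · exact ⟨k, hk1, not_lt.1 fun hlt => hp ⟨k, hlt, hk⟩⟩
      · exact ⟨k, hk1, hk⟩

theorem exists_isCommitted {m : ℕ → ℕ} (a : S m) :
    ∃ c : S m, IsCommitted c (state a) ∧
      a = c * PresentedMonoid.of (Rel m) Letter.y ^ (state a).run := by
  induction a using Submonoid.induction_of_closure_eq_top_right
    (PresentedMonoid.closure_range_of (Rel m)) with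
  | one =>
    rw [state_one]
    exact ⟨1, ⟨⟨[], rfl, by simp, rfl⟩, fun h => absurd rfl h, fun _ => rfl, fun h => absurd rfl h⟩,
      by simp [init]⟩
  | mul_right a t ht ih =>
    obtain ⟨l, rfl⟩ := ht
    obtain ⟨c, hc, ha⟩ := ih
    rw [state_mul_of]
    cases l with
    | x =>
      obtain ⟨c', hc', h'⟩ := hc.stepX
      exact ⟨c', hc', by simp only [step, stepX_run, pow_zero, mul_one]; rw [h', ← ha]⟩
    | y =>
      refine ⟨c, ⟨hc.isProdOf, hc.eq_mul_x, hc.maxGap_eq_zero, hc.eq_gap⟩, ?_⟩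
      simp only [step, stepY]
      rw [pow_succ, ← mul_assoc, ← ha]

theorem exists_isProdOf {m : ℕ → ℕ} (a : S m) : IsProdOf (gens m) (state a).length a := by
  obtain ⟨c, h1, h2⟩ := exists_isCommitted a
  have h3 := h1.isProdOf.mul_pow (y_mem_gens m) (state a).run
  rwa [← h2] at h3

theorem length_state_le {m : ℕ → ℕ} (l : List (S m)) (hl : ∀ t ∈ l, t ∈ gens m) :
    (state l.prod).length ≤ l.length := by
  induction l using List.reverseRecOn with
  | nil => simp [state_one, init, State.length]
  | append_singleton l t ih =>
    have ih' := ih fun s hs => hl s (by simp [hs])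
    have ht : t ∈ gens m := hl t (by simp)
    rw [List.prod_append, List.prod_singleton, List.length_append, List.length_singleton]
    have key : ∃ q, t = PresentedMonoid.of (Rel m) q := by
      rcases ht with ht | ht
      · exact ⟨_, ht⟩
      · exact ⟨_, ht⟩
    obtain ⟨q, rfl⟩ := key
    rw [state_mul_of]
    exact (length_step_le m q _).trans (by omega)

theorem wordLength_eq {m : ℕ → ℕ} (a : S m) : wordLength (gens m) a = (state a).length := by
  apply le_antisymm
  · exact Nat.sInf_le (exists_isProdOf a)
  · obtain ⟨l, h1, h2, h3⟩ := Nat.sInf_mem (s := {k | IsProdOf (gens m) k a}) ⟨_, exists_isProdOf a⟩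
    have h4 := length_state_le l h2
    rw [h3, h1] at h4
    exact h4

/-! ### Means over uniformly random words -/

section WalkMean

variable {α : Type*} (a b : α → α) (s : α)

/-- The mean of `F` after `n` steps, each of which applies `a` or `b` with probability `1/2`. -/
noncomputable def walkMean : ℕ → (α → ℝ) → ℝ
  | 0, F => F s
  | n + 1, F => walkMean n fun u => (F (a u) + F (b u)) / 2

theorem walkMean_zero (F : α → ℝ) : walkMean a b s 0 F = F s := rfl

theorem walkMean_add (n : ℕ) (F G : α → ℝ) :
    walkMean a b s n (fun u => F u + G u) = walkMean a b s n F + walkMean a b s n G := by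
  induction n generalizing F G with
  | zero => rfl
  | succ n ih =>
    simp only [walkMean]
    rw [← ih]
    congr 1
    funext u
    ring

theorem walkMean_const_mul (n : ℕ) (c : ℝ) (F : α → ℝ) :
    walkMean a b s n (fun u => c * F u) = c * walkMean a b s n F := by
  induction n generalizing F with
  | zero => rfl
  | succ n ih =>
    simp only [walkMean]
    rw [← ih]
    congr 1
    funext u
    ring

theorem walkMean_const (n : ℕ) (c : ℝ) : walkMean a b s n (fun _ => c) = c := by
  induction n with
  | zero => rfl
  | succ n ih => simpa [walkMean] using ih

theorem walkMean_mono (n : ℕ) {F G : α → ℝ} (h : ∀ u, F u ≤ G u) :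
    walkMean a b s n F ≤ walkMean a b s n G := by
  induction n generalizing F G with
  | zero => exact h s
  | succ n ih => exact ih fun u => by linarith [h (a u), h (b u)]

theorem walkMean_nonneg (n : ℕ) {F : α → ℝ} (h : ∀ u, 0 ≤ F u) : 0 ≤ walkMean a b s n F :=
  (walkMean_const a b s n 0).symm.trans_le (walkMean_mono a b s n h)

theorem walkMean_succ (n : ℕ) (F : α → ℝ) :
    walkMean a b s (n + 1) F =
      (walkMean a b s n (fun u => F (a u)) + walkMean a b s n (fun u => F (b u))) / 2 := by
  rw [← walkMean_add, div_eq_inv_mul, ← walkMean_const_mul]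
  simp only [walkMean]
  congr 1
  funext u
  ring

/-- Decomposition according to the length of the last run of `b`-steps. -/
theorem walkMean_eq_sum (n : ℕ) (F : α → ℝ) :
    walkMean a b s n F = (1 / 2 : ℝ) ^ n * F (b^[n] s) +
      ∑ j ∈ Finset.range n,
        (1 / 2 : ℝ) ^ (j + 1) * walkMean a b s (n - (j + 1)) fun u => F (b^[j] (a u)) := by
  induction n generalizing F with
  | zero => simp [walkMean]
  | succ n ih =>
    have key : ∀ j, (1 / 2 : ℝ) ^ (j + 1 + 1) *
        walkMean a b s (n + 1 - (j + 1 + 1)) (fun u => F (b^[j + 1] (a u))) =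
        1 / 2 * ((1 / 2 : ℝ) ^ (j + 1) *
          walkMean a b s (n - (j + 1)) fun u => F (b (b^[j] (a u)))) := by
      intro j
      simp only [Function.iterate_succ_apply', Nat.add_sub_add_right]
      ring
    rw [walkMean_succ, ih fun u => F (b u), Finset.sum_range_succ', Finset.sum_congr rfl
      fun j _ => key j, ← Finset.mul_sum, Function.iterate_succ_apply']
    simp only [Function.iterate_zero, id, zero_add, Nat.add_sub_cancel]
    ring

theorem walkMean_comp {γ : Type*} (a' b' : γ → γ) (s' : γ) (φ : α → γ) (ha : ∀ u, φ (a u) = a' (φ u))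
    (hb : ∀ u, φ (b u) = b' (φ u)) (hs : φ s = s') (n : ℕ) (F : γ → ℝ) :
    walkMean a b s n (fun u => F (φ u)) = walkMean a' b' s' n F := by
  induction n generalizing F with
  | zero => simp [walkMean, hs]
  | succ n ih =>
    simp only [walkMean, ha, hb]
    exact ih fun v => (F (a' v) + F (b' v)) / 2

end WalkMean

/-! ### Waiting time for the pattern `x y^M` -/

/-- The mean of `F` at the state of a uniformly random word of length `n`. -/
noncomputable def stateMean (m : ℕ → ℕ) : ℕ → (State → ℝ) → ℝ := walkMean (stepX m) stepY init

open Classical in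
/-- The indicator of the event that no letter `x` has been followed by `M` letters `y`. -/
noncomputable def noLongRun (M : ℕ) (σ : State) : ℝ :=
  if σ.maxGap < M ∧ (σ.committed = 0 ∨ σ.run < M) then 1 else 0

theorem noLongRun_nonneg (M : ℕ) (σ : State) : 0 ≤ noLongRun M σ := by
  unfold noLongRun
  split_ifs <;> norm_num

theorem noLongRun_le_one (M : ℕ) (σ : State) : noLongRun M σ ≤ 1 := by
  unfold noLongRun
  split_ifs <;> norm_num

theorem maxGap_stepX_lt_iff {m : ℕ → ℕ} {M : ℕ} (σ : State) :
    (stepX m σ).maxGap < M ↔ σ.maxGap < M ∧ (σ.committed = 0 ∨ σ.run < M) := by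
  by_cases h : σ.committed = 0
  · simp [stepX, h]
  · simp [stepX, h]

theorem noLongRun_stepX (m : ℕ → ℕ) {M : ℕ} (hM : 1 ≤ M) (σ : State) :
    noLongRun M (stepX m σ) = noLongRun M σ := by
  have h : (stepX m σ).run < M := by rw [stepX_run]; omega
  simp only [noLongRun, maxGap_stepX_lt_iff, h, or_true, and_true]

open Classical in
theorem noLongRun_stepY (M : ℕ) (σ : State) :
    noLongRun M (stepY σ) = noLongRun M σ -
      if σ.maxGap < M ∧ σ.committed ≠ 0 ∧ σ.run + 1 = M then 1 else 0 := by
  simp only [noLongRun, stepY]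
  by_cases h1 : σ.maxGap < M <;> by_cases h2 : σ.committed = 0 <;> simp only [h1, h2, true_and,
    false_and, true_or, false_or, if_true, if_false, ne_eq, not_true, not_false_iff, sub_zero]
  rcases lt_trichotomy (σ.run + 1) M with h | h | h
  · rw [if_pos h, if_pos (by omega), if_neg (by omega)]; norm_num
  · rw [if_neg (by omega), if_pos (by omega), if_pos h]; norm_num
  · rw [if_neg (by omega), if_neg (by omega), if_neg (by omega)]; norm_num

/-- The probability that `x y^M` does not occur in a uniformly random word of length `n`. -/
noncomputable def avoid (m : ℕ → ℕ) (M n : ℕ) : ℝ := stateMean m n (noLongRun M)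

theorem avoid_nonneg (m : ℕ → ℕ) (M n : ℕ) : 0 ≤ avoid m M n :=
  walkMean_nonneg _ _ _ _ (noLongRun_nonneg M)

theorem avoid_le_one (m : ℕ → ℕ) (M n : ℕ) : avoid m M n ≤ 1 :=
  (walkMean_mono _ _ _ _ (noLongRun_le_one M)).trans_eq (walkMean_const _ _ _ _ _)

theorem avoid_zero (m : ℕ → ℕ) {M : ℕ} (hM : 1 ≤ M) : avoid m M 0 = 1 := by
  simp only [avoid, stateMean, walkMean_zero, noLongRun, init]
  rw [if_pos ⟨by omega, by simp⟩]

/-- The pattern `x y^M` does not overlap itself, so it first appears at time `n + 1` exactly when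
the word is `u x y^M` with `u` avoiding it; the last `M + 1` letters cost `2^(-(M+1))`. -/
theorem avoid_succ (m : ℕ → ℕ) {M : ℕ} (hM : 1 ≤ M) (n : ℕ) :
    avoid m M (n + 1) = avoid m M n -
      if M ≤ n then (1 / 2 : ℝ) ^ (M + 1) * avoid m M (n - M) else 0 := by
  classical
  let f : State → ℝ := fun σ => if σ.maxGap < M ∧ σ.committed ≠ 0 ∧ σ.run + 1 = M then 1 else 0
  have hf : stateMean m n f = if M ≤ n then (1 / 2 : ℝ) ^ M * avoid m M (n - M) else 0 := by
    rw [stateMean, walkMean_eq_sum]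
    have h0 : f (stepY^[n] init) = 0 := if_neg (by simp [stepY_iterate, init])
    have h1 : ∀ j u, f (stepY^[j] (stepX m u)) = (if j + 1 = M then 1 else 0) * noLongRun M u := by
      intro j u
      simp only [f, stepY_iterate, stepX_run, zero_add, noLongRun, maxGap_stepX_lt_iff, ne_eq,
        stepX_committed_ne_zero, not_false_iff, true_and]
      by_cases hj : j + 1 = M <;> simp [hj]
    simp only [h0, h1, walkMean_const_mul, mul_zero, zero_add]
    obtain ⟨M, rfl⟩ : ∃ k, M = k + 1 := ⟨M - 1, by omega⟩
    simp only [Nat.add_right_cancel_iff]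
    by_cases hn : M + 1 ≤ n
    · rw [if_pos hn, Finset.sum_eq_single M]
      · simp [avoid, stateMean]
      · intro j _ hj
        simp [hj]
      · intro h
        exact absurd (Finset.mem_range.2 hn) h
    · rw [if_neg hn]
      refine Finset.sum_eq_zero fun j hj => ?_
      rw [if_neg (by have := Finset.mem_range.1 hj; omega)]
      ring
  have hsub : stateMean m n (fun σ => noLongRun M (stepY σ)) = avoid m M n + -1 * stateMean m n f := by
    rw [stateMean, ← walkMean_const_mul, avoid, stateMean, ← walkMean_add]
    congr 1
    funext σ
    rw [noLongRun_stepY]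
    simp only [f]
    ring
  have hx : stateMean m n (fun σ => noLongRun M (stepX m σ)) = avoid m M n := by
    simp only [noLongRun_stepX m hM]
    rfl
  rw [avoid, stateMean, walkMean_succ]
  change (stateMean m n _ + stateMean m n _) / 2 = _
  rw [hsub, hx, hf]
  split_ifs <;> ring

/-- The recursion `avoid_succ`, shifted by `M`, telescopes. -/
theorem sum_avoid (m : ℕ → ℕ) {M : ℕ} (hM : 1 ≤ M) (n : ℕ) :
    (1 / 2 : ℝ) ^ (M + 1) * ∑ s ∈ Finset.range n, avoid m M s = avoid m M M - avoid m M (n + M) := by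
  induction n with
  | zero => simp
  | succ n ih =>
    rw [Finset.sum_range_succ, mul_add, ih, Nat.add_right_comm, avoid_succ m hM (n + M),
      if_pos (by omega), Nat.add_sub_cancel]
    ring

theorem sum_avoid_le (m : ℕ → ℕ) {M : ℕ} (hM : 1 ≤ M) (n : ℕ) :
    ∑ s ∈ Finset.range n, avoid m M s ≤ 2 ^ (M + 1) := by
  have h := sum_avoid m hM n
  have h1 := avoid_le_one m M M
  have h2 := avoid_nonneg m M (n + M)
  have h3 : (1 / 2 : ℝ) ^ (M + 1) * 2 ^ (M + 1) = 1 := by rw [← mul_pow]; norm_num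
  have h4 : (0 : ℝ) < (1 / 2) ^ (M + 1) := by positivity
  nlinarith

theorem one_sub_le_avoid (m : ℕ → ℕ) {M : ℕ} (hM : 1 ≤ M) (n : ℕ) :
    1 - n * (1 / 2 : ℝ) ^ (M + 1) ≤ avoid m M n := by
  induction n with
  | zero => simp [avoid_zero m hM]
  | succ n ih =>
    have h4 : (0 : ℝ) < (1 / 2) ^ (M + 1) := by positivity
    rw [avoid_succ m hM]
    push_cast
    split_ifs
    · nlinarith [avoid_le_one m M (n - M)]
    · linarith

theorem le_sum_avoid (m : ℕ → ℕ) {M N : ℕ} (hM : 2 ≤ M) (hN : 2 ^ (M - 2) ≤ N) :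
    (2 : ℝ) ^ M / 8 ≤ ∑ s ∈ Finset.range N, avoid m M s := by
  obtain ⟨M, rfl⟩ : ∃ k, M = k + 2 := ⟨M - 2, by omega⟩
  simp only [Nat.add_sub_cancel] at hN
  -- Up to time `2^M` the pattern `x y^(M+2)` has occurred with probability at most `1/8`.
  have h1 : ∑ s ∈ Finset.range (2 ^ M), (1 / 2 : ℝ) ≤
      ∑ s ∈ Finset.range (2 ^ M), avoid m (M + 2) s := by
    refine Finset.sum_le_sum fun s hs => ?_
    refine le_trans ?_ (one_sub_le_avoid m (by omega) s)
    have h2 : (s : ℝ) ≤ 2 ^ M := by exact_mod_cast (Finset.mem_range.1 hs).le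
    have h3 : (2 : ℝ) ^ M * (1 / 2) ^ (M + 2 + 1) = 1 / 8 := by
      rw [pow_add, pow_add, ← mul_assoc, ← mul_assoc, ← mul_pow]; norm_num
    have h4 : (0 : ℝ) < (1 / 2) ^ (M + 2 + 1) := by positivity
    nlinarith
  have h2 : ∑ s ∈ Finset.range (2 ^ M), avoid m (M + 2) s ≤
      ∑ s ∈ Finset.range N, avoid m (M + 2) s :=
    Finset.sum_le_sum_of_subset_of_nonneg (Finset.range_mono hN) fun s _ _ => avoid_nonneg _ _ _
  rw [Finset.sum_const, Finset.card_range, nsmul_eq_mul] at h1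
  refine le_trans (le_of_eq ?_) (h1.trans h2)
  push_cast
  ring

/-! ### Mean growth of the reduced word -/

open Classical in
/-- The growth of the committed length when the letter `x` is read. -/
noncomputable def increment (m : ℕ → ℕ) (σ : State) : ℝ :=
  if σ.committed = 0 ∨ (σ.run ≠ 0 ∧ ¬ Prec m σ.run σ.maxGap) then σ.run + 1 else 0

open Classical in
/-- The probability that a gap `y^j` is not absorbed when it follows `u x`, for a uniformly random
word `u` of length `n`. -/
noncomputable def keepProb (m : ℕ → ℕ) (j n : ℕ) : ℝ :=
  stateMean m n fun u => if Prec m j (stepX m u).maxGap then 0 else 1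

theorem keepProb_nonneg (m : ℕ → ℕ) (j n : ℕ) : 0 ≤ keepProb m j n :=
  walkMean_nonneg _ _ _ _ fun u => by split_ifs <;> norm_num

theorem keepProb_le_one (m : ℕ → ℕ) (j n : ℕ) : keepProb m j n ≤ 1 :=
  (walkMean_mono _ _ _ _ fun u => by split_ifs <;> norm_num).trans_eq
    (walkMean_const _ _ _ n 1)

/-- The first term of `m` above `j` is `m (k + 1)`, so `j` is absorbed exactly by maxima that reach
it. -/
theorem keepProb_eq_avoid {m : ℕ → ℕ} (hm : StrictMono m) {j k : ℕ} (h1 : m k ≤ j)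
    (h2 : j < m (k + 1)) (n : ℕ) : keepProb m j n = avoid m (m (k + 1)) n := by
  classical
  have key : ∀ h, Prec m j h ↔ ¬ h < m (k + 1) := by
    intro h
    constructor
    · rintro ⟨l, hl1, hl2⟩ hlt
      have h3 := hm.lt_iff_lt.1 (hl2.trans_lt hlt)
      have h4 := hm.monotone (Nat.lt_succ_iff.1 h3)
      omega
    · intro hh
      exact ⟨k + 1, h2, not_lt.1 hh⟩
  rw [keepProb, avoid]
  congr 1
  funext u
  simp only [key, noLongRun, maxGap_stepX_lt_iff]
  split_ifs <;> tauto

/-- The weight of a gap `y^j`. -/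
noncomputable def gapWeight (j : ℕ) : ℝ := if j = 0 then 0 else (j + 1) * (1 / 2 : ℝ) ^ (j + 1)

theorem gapWeight_nonneg (j : ℕ) : 0 ≤ gapWeight j := by
  unfold gapWeight
  split_ifs
  · exact le_rfl
  · positivity

/-- The isolated term is the word `y^t`, whose run is not yet a gap and is always kept by the first
`x`. Every other word is `u x y^j`. -/
theorem stateMean_increment (m : ℕ → ℕ) (t : ℕ) :
    stateMean m t (increment m) = (t + 1) * (1 / 2 : ℝ) ^ t +
      ∑ j ∈ Finset.range t, gapWeight j * keepProb m j (t - (j + 1)) := by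
  classical
  rw [stateMean, walkMean_eq_sum]
  congr 1
  · simp [stepY_iterate, increment, init, mul_comm]
  · refine Finset.sum_congr rfl fun j _ => ?_
    have h : ∀ u, increment m (stepY^[j] (stepX m u)) =
        (if j = 0 then 0 else (j + 1 : ℝ)) *
          if Prec m j (stepX m u).maxGap then 0 else 1 := by
      intro u
      simp only [increment, stepY_iterate, stepX_run, zero_add, stepX_committed_ne_zero, false_or]
      by_cases h1 : j = 0 <;> by_cases h2 : Prec m j (stepX m u).maxGap <;> simp [h1, h2]
    simp only [h, walkMean_const_mul, gapWeight, keepProb, stateMean]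
    split_ifs <;> ring

theorem stateMean_committed (m : ℕ → ℕ) (n : ℕ) :
    stateMean m n (fun σ => (σ.committed : ℝ)) =
      ∑ t ∈ Finset.range n, 1 / 2 * stateMean m t (increment m) := by
  induction n with
  | zero => simp [stateMean, walkMean_zero, init]
  | succ n ih =>
    rw [Finset.sum_range_succ, ← ih]
    simp only [stateMean]
    rw [← walkMean_const_mul, ← walkMean_add]
    simp only [walkMean]
    congr 1
    funext σ
    simp only [stepY, stepX, increment]
    split_ifs
    · push_cast; ring
    · ring

theorem stateMean_committed_eq (m : ℕ → ℕ) (n : ℕ) :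
    stateMean m n (fun σ => (σ.committed : ℝ)) =
      1 / 2 * ∑ t ∈ Finset.range n, (t + 1) * (1 / 2 : ℝ) ^ t +
      1 / 2 * ∑ j ∈ Finset.range n, gapWeight j *
        ∑ s ∈ Finset.range (n - (j + 1)), keepProb m j s := by
  rw [stateMean_committed, ← Finset.mul_sum]
  simp only [stateMean_increment]
  rw [Finset.sum_add_distrib, mul_add]
  congr 2
  -- Sum over the gap length first, with `t = j + 1 + s`, where `s` is the length of the prefix
  -- before the `x` opening the gap.
  rw [Finset.sum_comm' (t' := Finset.range n) (s' := fun j => Finset.Ico (j + 1) n)]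
  · refine Finset.sum_congr rfl fun j _ => ?_
    rw [Finset.sum_Ico_eq_sum_range, Finset.mul_sum]
    refine Finset.sum_congr rfl fun s _ => ?_
    rw [Nat.add_sub_cancel_left]
  · intro t j
    simp only [Finset.mem_range, Finset.mem_Ico]
    omega

theorem stateMean_run_le (m : ℕ → ℕ) (n : ℕ) : stateMean m n (fun σ => (σ.run : ℝ)) ≤ 1 := by
  induction n with
  | zero => simp [stateMean, walkMean_zero, init]
  | succ n ih =>
    have h : stateMean m (n + 1) (fun σ => (σ.run : ℝ)) =
        1 / 2 * stateMean m n (fun σ => (σ.run : ℝ)) + stateMean m n (fun _ => 1 / 2) := by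
      simp only [stateMean]
      rw [← walkMean_const_mul, ← walkMean_add]
      simp only [walkMean]
      congr 1
      funext σ
      simp only [stepX, stepY]
      push_cast
      ring
    have hc : stateMean m n (fun _ => (1 / 2 : ℝ)) = 1 / 2 := walkMean_const _ _ _ _ _
    linarith

theorem sum_range_succ_mul_half_pow_le (n : ℕ) :
    ∑ t ∈ Finset.range n, ((t : ℝ) + 1) * (1 / 2 : ℝ) ^ t ≤ 4 := by
  have h : ∑ t ∈ Finset.range n, ((t : ℝ) + 1) * (1 / 2 : ℝ) ^ t =
      4 - (n + 2) * 2 * (1 / 2 : ℝ) ^ n := by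
    induction n with
    | zero => norm_num
    | succ n ih =>
      rw [Finset.sum_range_succ, ih]
      push_cast
      ring
  have h2 : 0 ≤ ((n : ℝ) + 2) * 2 * (1 / 2 : ℝ) ^ n := by positivity
  linarith

theorem sum_gapWeight_le {p q : ℕ} (hp : 1 ≤ p) (hpq : p ≤ q) :
    ∑ j ∈ Finset.Ico p q, gapWeight j ≤ 3 * p * (1 / 2 : ℝ) ^ p := by
  -- `gapWeight j` is the decrement of `(j + 2) 2^(-j)`, so the sum telescopes.
  have h : ∑ j ∈ Finset.Ico p q, gapWeight j =
      (p + 2) * (1 / 2 : ℝ) ^ p - (q + 2) * (1 / 2 : ℝ) ^ q := by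
    induction q, hpq using Nat.le_induction with
    | base => simp
    | succ q hq ih =>
      rw [Finset.sum_Ico_succ_top hq, ih, gapWeight, if_neg (by omega)]
      push_cast
      ring
  have h2 : 0 ≤ ((q : ℝ) + 2) * (1 / 2 : ℝ) ^ q := by positivity
  have h3 : (1 : ℝ) ≤ p := by exact_mod_cast hp
  have h4 : (0 : ℝ) < (1 / 2) ^ p := by positivity
  nlinarith

/-! ### Comparison with `gamma` -/

theorem le_logb_two_iff {n : ℕ} (hn : 0 < n) (k : ℕ) :
    (k : ℝ) ≤ Real.logb 2 n ↔ 2 ^ k ≤ n := by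
  rw [Real.le_logb_iff_rpow_le one_lt_two (by exact_mod_cast hn), Real.rpow_natCast]
  exact_mod_cast Iff.rfl

theorem exists_index {m : ℕ → ℕ} (hm : StrictMono m) {n : ℕ} (hn : 0 < n) :
    ∃ N, ∀ k, (m (k + 1) : ℝ) ≤ Real.logb 2 n ↔ k < N := by
  have hex : ∃ k, ¬ 2 ^ m (k + 1) ≤ n :=
    ⟨n, not_le.2 (n.lt_two_pow_self.trans_le
      (Nat.pow_le_pow_right two_pos ((Nat.le_succ n).trans (hm.id_le _))))⟩
  classical
  refine ⟨Nat.find hex, fun k => ?_⟩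
  rw [le_logb_two_iff hn]
  constructor
  · intro h
    by_contra hk
    exact Nat.find_spec hex
      ((Nat.pow_le_pow_right two_pos (hm.monotone (by omega))).trans h)
  · intro h
    exact not_not.1 (Nat.find_min hex h)

theorem gamma_eq_sum {m : ℕ → ℕ} {n N : ℕ}
    (hN : ∀ k, (m (k + 1) : ℝ) ≤ Real.logb 2 n ↔ k < N) :
    gamma m n = ∑ k ∈ Finset.range N, m k * ((1 / 2 : ℝ) ^ m k * 2 ^ m (k + 1)) := by
  unfold gamma
  simp only [hN, ← Finset.mem_range]
  rw [finsum_mem_finset_eq_sum]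
  refine Finset.sum_congr rfl fun k _ => ?_
  rw [zpow_sub₀ two_ne_zero, zpow_natCast, zpow_natCast, one_div, inv_pow]
  ring

theorem sum_Ico_strictMono {m : ℕ → ℕ} (hm : Monotone m) (f : ℕ → ℝ) (N : ℕ) :
    ∑ j ∈ Finset.Ico (m 0) (m N), f j =
      ∑ k ∈ Finset.range N, ∑ j ∈ Finset.Ico (m k) (m (k + 1)), f j := by
  induction N with
  | zero => simp
  | succ N ih =>
    rw [Finset.sum_range_succ, ← ih, Finset.sum_Ico_consecutive _ (hm N.zero_le) (hm N.le_succ)]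

theorem stateMean_length (m : ℕ → ℕ) (n : ℕ) :
    stateMean m n (fun σ => (σ.length : ℝ)) =
      stateMean m n (fun σ => (σ.committed : ℝ)) + stateMean m n (fun σ => (σ.run : ℝ)) := by
  simp only [stateMean, State.length, Nat.cast_add]
  exact walkMean_add _ _ _ _ _ _

/-- Only the gaps of length exactly `m k` are retained. Of the constant `1/32`, a factor `1/2` is
the probability of reading `x`, `1/2` comes from `gapWeight` and `1/8` from `le_sum_avoid`. -/
theorem gamma_le_stateMean_length {m : ℕ → ℕ} (hm : StrictMono m) (h0 : m 0 = 1) {n : ℕ}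
    (hn : 0 < n) : 1 / 32 * gamma m n ≤ stateMean m n (fun σ => (σ.length : ℝ)) := by
  obtain ⟨N, hN⟩ := exists_index hm hn
  have hrun : 0 ≤ stateMean m n (fun σ => (σ.run : ℝ)) :=
    walkMean_nonneg _ _ _ _ fun σ => Nat.cast_nonneg _
  have hfirst : 0 ≤ ∑ t ∈ Finset.range n, ((t : ℝ) + 1) * (1 / 2 : ℝ) ^ t :=
    Finset.sum_nonneg fun t _ => by positivity
  let f : ℕ → ℝ := fun j => gapWeight j * ∑ s ∈ Finset.range (n - (j + 1)), keepProb m j s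
  have hsub : (Finset.range N).image m ⊆ Finset.range n := by
    intro j hj
    obtain ⟨k, hk, rfl⟩ := Finset.mem_image.1 hj
    have h1 := (le_logb_two_iff hn _).1 ((hN k).2 (Finset.mem_range.1 hk))
    have h2 : m (k + 1) < 2 ^ m (k + 1) := Nat.lt_two_pow_self
    have h3 := hm (Nat.lt_add_one k)
    exact Finset.mem_range.2 (by omega)
  have hle : ∑ k ∈ Finset.range N, f (m k) ≤ ∑ j ∈ Finset.range n, f j := by
    rw [← Finset.sum_image (f := f) fun a _ b _ h => hm.injective h]
    exact Finset.sum_le_sum_of_subset_of_nonneg hsub fun j _ _ =>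
      mul_nonneg (gapWeight_nonneg j) (Finset.sum_nonneg fun s _ => keepProb_nonneg m j s)
  have hgamma : 1 / 16 * gamma m n ≤ ∑ k ∈ Finset.range N, f (m k) := by
    rw [gamma_eq_sum hN, Finset.mul_sum]
    refine Finset.sum_le_sum fun k hk => ?_
    have h1 := (le_logb_two_iff hn _).1 ((hN k).2 (Finset.mem_range.1 hk))
    have h3 := hm (Nat.lt_add_one k)
    have h4 : 1 ≤ m k := h0 ▸ hm.monotone k.zero_le
    simp only [f, keepProb_eq_avoid hm le_rfl h3]
    have h5 : 2 ^ (m (k + 1) - 2) ≤ n - (m k + 1) := by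
      obtain ⟨M, hM⟩ : ∃ M, m (k + 1) = M + 2 := ⟨m (k + 1) - 2, by omega⟩
      have h6 : M < 2 ^ M := Nat.lt_two_pow_self
      rw [hM] at h1 h3 ⊢
      rw [pow_add] at h1
      rw [Nat.add_sub_cancel]
      omega
    have h6 := le_sum_avoid m (M := m (k + 1)) (by omega) h5
    have h7 : (m k : ℝ) * (1 / 2 : ℝ) ^ m k / 2 ≤ gapWeight (m k) := by
      rw [gapWeight, if_neg (by omega), pow_succ]
      have : (0 : ℝ) < (1 / 2) ^ m k := by positivity
      nlinarith
    calc 1 / 16 * (m k * ((1 / 2 : ℝ) ^ m k * 2 ^ m (k + 1)))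
        = (m k : ℝ) * (1 / 2 : ℝ) ^ m k / 2 * (2 ^ m (k + 1) / 8) := by ring
      _ ≤ _ := mul_le_mul h7 h6 (by positivity) (gapWeight_nonneg _)
  rw [stateMean_length, stateMean_committed_eq]
  simp only [f] at hle hgamma
  linarith

theorem stateMean_length_le {m : ℕ → ℕ} (hm : StrictMono m) (h0 : m 0 = 1) {n N : ℕ}
    (hN : ∀ k, (m (k + 1) : ℝ) ≤ Real.logb 2 n ↔ k < N) :
    stateMean m n (fun σ => (σ.length : ℝ)) ≤
      3 + 3 * gamma m n + 3 * (m N * (1 / 2 : ℝ) ^ m N * n) := by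
  have hpos : ∀ k, 1 ≤ m k := fun k => h0 ▸ hm.monotone k.zero_le
  let f : ℕ → ℝ := fun j => gapWeight j * ∑ s ∈ Finset.range n, keepProb m j s
  have hf : ∀ j, 0 ≤ f j := fun j =>
    mul_nonneg (gapWeight_nonneg j) (Finset.sum_nonneg fun s _ => keepProb_nonneg m j s)
  have h1 : ∑ j ∈ Finset.range n, gapWeight j *
      ∑ s ∈ Finset.range (n - (j + 1)), keepProb m j s ≤ ∑ j ∈ Finset.range n, f j :=
    Finset.sum_le_sum fun j _ => mul_le_mul_of_nonneg_left
      (Finset.sum_le_sum_of_subset_of_nonneg (Finset.range_mono (Nat.sub_le _ _))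
        fun s _ _ => keepProb_nonneg m j s) (gapWeight_nonneg j)
  -- Enlarging the range ensures that it contains every block below `m N`.
  have h2 : ∑ j ∈ Finset.range n, f j ≤ ∑ j ∈ Finset.range (m N + n), f j :=
    Finset.sum_le_sum_of_subset_of_nonneg (Finset.range_mono (Nat.le_add_left _ _))
      fun j _ _ => hf j
  have h3 : ∑ j ∈ Finset.range (m N + n), f j =
      ∑ k ∈ Finset.range N, ∑ j ∈ Finset.Ico (m k) (m (k + 1)), f j +
        ∑ j ∈ Finset.Ico (m N) (m N + n), f j := by
    rw [← sum_Ico_strictMono hm.monotone, Finset.sum_Ico_consecutive _ (hm.monotone N.zero_le)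
      (Nat.le_add_right _ _), h0, Finset.range_eq_Ico,
      Finset.sum_eq_sum_Ico_succ_bot (by have := hpos N; omega)]
    simp [f, gapWeight]
  have h4 : ∑ k ∈ Finset.range N, ∑ j ∈ Finset.Ico (m k) (m (k + 1)), f j ≤ 6 * gamma m n := by
    rw [gamma_eq_sum hN, Finset.mul_sum]
    refine Finset.sum_le_sum fun k _ => ?_
    have h5 : ∑ j ∈ Finset.Ico (m k) (m (k + 1)), f j ≤
        ∑ j ∈ Finset.Ico (m k) (m (k + 1)), gapWeight j * 2 ^ (m (k + 1) + 1) := by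
      refine Finset.sum_le_sum fun j hj => ?_
      obtain ⟨hj1, hj2⟩ := Finset.mem_Ico.1 hj
      simp only [f, keepProb_eq_avoid hm hj1 hj2]
      exact mul_le_mul_of_nonneg_left (sum_avoid_le m (hpos _) n) (gapWeight_nonneg j)
    rw [← Finset.sum_mul] at h5
    refine (h5.trans (mul_le_mul_of_nonneg_right
      (sum_gapWeight_le (hpos k) (hm.monotone k.le_succ)) (by positivity))).trans_eq ?_
    ring
  have h5 : ∑ j ∈ Finset.Ico (m N) (m N + n), f j ≤ 3 * (m N * (1 / 2 : ℝ) ^ m N * n) := by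
    have h6 : ∑ j ∈ Finset.Ico (m N) (m N + n), f j ≤
        ∑ j ∈ Finset.Ico (m N) (m N + n), gapWeight j * n := by
      refine Finset.sum_le_sum fun j _ => mul_le_mul_of_nonneg_left ?_ (gapWeight_nonneg j)
      refine (Finset.sum_le_sum fun s _ => keepProb_le_one m j s).trans_eq ?_
      simp
    rw [← Finset.sum_mul] at h6
    refine (h6.trans (mul_le_mul_of_nonneg_right
      (sum_gapWeight_le (hpos N) (Nat.le_add_right _ _)) (Nat.cast_nonneg n))).trans_eq ?_
    ring
  have h6 := sum_range_succ_mul_half_pow_le n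
  have h7 := stateMean_run_le m n
  have h8 : (0 : ℝ) ≤ m N * (1 / 2 : ℝ) ^ m N * n := by positivity
  rw [stateMean_length, stateMean_committed_eq]
  linarith

/-- Maximality of `N` gives `log₂ n < β m_N + δ`, so `2^(-m_N)` is at most `2^(δ/β) n^(-1/β)`; the
factor `m_N` is at most `log₂ n`. -/
theorem tail_le {β δ : ℝ} (hβ : 1 ≤ β) {m : ℕ → ℕ} (h0 : m 0 = 1)
    (hgrowth : ∀ i : ℕ, (m (i + 1) : ℝ) ≤ β * (m i : ℝ) + δ) {n N : ℕ} (hn : 2 ≤ n)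
    (hN : ∀ k, (m (k + 1) : ℝ) ≤ Real.logb 2 n ↔ k < N) :
    m N * (1 / 2 : ℝ) ^ m N * n ≤
      (2 : ℝ) ^ (δ / β) * ((n : ℝ) ^ ((β - 1) / β) * Real.logb 2 n) := by
  have hβ0 : 0 < β := by linarith
  have hn0 : (0 : ℝ) < n := by exact_mod_cast (by omega : 0 < n)
  have hlog : (m N : ℝ) ≤ Real.logb 2 n := by
    -- For `N = 0` the bound is `1 ≤ log₂ n`, which needs `n ≥ 2`.
    cases N with
    | zero =>
      rw [le_logb_two_iff (by omega), h0]
      omega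
    | succ N => exact (hN N).2 (Nat.lt_succ_self N)
  have hlt : Real.logb 2 n < m (N + 1) := not_le.1 fun h => lt_irrefl N ((hN N).1 h)
  have h1 : Real.logb 2 n ≤ β * m N + δ := (hlt.trans_le (hgrowth N)).le
  have h2 : (1 / 2 : ℝ) ^ m N * n ≤ (2 : ℝ) ^ (δ / β) * (n : ℝ) ^ ((β - 1) / β) := by
    have h3 : (n : ℝ) = (2 : ℝ) ^ Real.logb 2 n :=
      (Real.rpow_logb two_pos (by norm_num) hn0).symm
    generalize Real.logb 2 n = L at *
    rw [h3, one_div, inv_pow, ← Real.rpow_natCast, ← Real.rpow_neg two_pos.le,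
      ← Real.rpow_mul two_pos.le, ← Real.rpow_add two_pos, ← Real.rpow_add two_pos]
    refine Real.rpow_le_rpow_of_exponent_le one_le_two ?_
    have h4 : L / β ≤ m N + δ / β := by
      rw [div_le_iff₀ hβ0, add_mul, div_mul_cancel₀ _ hβ0.ne']
      linarith
    have h5 : L * ((β - 1) / β) = L - L / β := by field_simp
    linarith
  have hL : 0 ≤ Real.logb 2 n := (Nat.cast_nonneg _).trans hlog
  calc m N * (1 / 2 : ℝ) ^ m N * n = m N * ((1 / 2 : ℝ) ^ m N * n) := by ring
    _ ≤ Real.logb 2 n * ((2 : ℝ) ^ (δ / β) * (n : ℝ) ^ ((β - 1) / β)) := by gcongr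
    _ = _ := by ring

theorem stateMean_length_le_gamma {β δ : ℝ} (hβ : 1 ≤ β) {m : ℕ → ℕ}
    (hm : StrictMono m) (h0 : m 0 = 1)
    (hgrowth : ∀ i : ℕ, (m (i + 1) : ℝ) ≤ β * (m i : ℝ) + δ) {n : ℕ} (hn : 2 ≤ n) :
    stateMean m n (fun σ => (σ.length : ℝ)) ≤ (3 + 3 * (2 : ℝ) ^ (δ / β)) *
      (gamma m n + (n : ℝ) ^ ((β - 1) / β) * Real.logb 2 n) := by
  obtain ⟨N, hN⟩ := exists_index hm (by omega : 0 < n)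
  have h1 := stateMean_length_le hm h0 hN
  have h2 := tail_le hβ h0 hgrowth hn hN
  have h3 : (1 : ℝ) ≤ Real.logb 2 n := by
    have := (le_logb_two_iff (by omega : 0 < n) 1).2 (by omega)
    exact_mod_cast this
  have h4 : (1 : ℝ) ≤ (n : ℝ) ^ ((β - 1) / β) :=
    Real.one_le_rpow (by exact_mod_cast (by omega : 1 ≤ n))
      (div_nonneg (by linarith) (by linarith))
  have h5 : (1 : ℝ) ≤ (n : ℝ) ^ ((β - 1) / β) * Real.logb 2 n := one_le_mul_of_one_le_of_one_le h4 h3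
  have h6 : 0 ≤ gamma m n := by
    rw [gamma_eq_sum hN]
    exact Finset.sum_nonneg fun k _ => by positivity
  have h7 : (0 : ℝ) ≤ (2 : ℝ) ^ (δ / β) * gamma m n := by positivity
  linarith

/-! ### From the random walk to means over words -/

instance : Countable Letter :=
  Function.Injective.countable (f := fun l => match l with
    | Letter.x => true
    | Letter.y => false) fun a b h => by cases a <;> cases b <;> simp_all

instance (m : ℕ → ℕ) : Countable (S m) :=
  haveI : Countable (FreeMonoid Letter) := inferInstanceAs (Countable (List Letter))
  PresentedMonoid.surjective_mk.countable

instance (m : ℕ → ℕ) : DiscreteMeasurableSpace (S m) := ⟨fun _ => trivial⟩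

/-- `R n` is a measurable function of the steps before `X n`. -/
theorem indepFun_randomWalk {M : Type*} [Monoid M] [MeasurableSpace M] [MeasurableMul₂ M]
    {Ω : Type*} [MeasurableSpace Ω] {P : Measure Ω} {R X : ℕ → Ω → M}
    (hX : ∀ i, Measurable (X i)) (hind : iIndepFun X P) (h0 : ∀ ω, R 0 ω = 1)
    (hR : ∀ n ω, R (n + 1) ω = R n ω * X n ω) (n : ℕ) : IndepFun (R n) (X n) P := by
  have key : ∀ k, ∃ φ : (Finset.range k → M) → M, Measurable φ ∧
      R k = φ ∘ fun ω (i : Finset.range k) => X i ω := by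
    intro k
    induction k with
    | zero => exact ⟨fun _ => 1, measurable_const, funext h0⟩
    | succ k ih =>
      obtain ⟨φ, hφ, hk⟩ := ih
      refine ⟨fun v => φ (fun i => v ⟨i, Finset.range_mono k.le_succ i.2⟩) *
        v ⟨k, Finset.self_mem_range_succ k⟩, ?_, ?_⟩
      · exact (hφ.comp (measurable_pi_lambda _ fun i => measurable_pi_apply _)).mul
          (measurable_pi_apply _)
      · funext ω
        rw [hR, hk]
        rfl
  obtain ⟨φ, hφ, hn⟩ := key n
  have h := hind.indepFun_finset (Finset.range n) {n} (by simp) hX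
  rw [hn]
  exact h.comp (ψ := fun v : (({n} : Finset ℕ) → M) => v ⟨n, Finset.mem_singleton_self n⟩) hφ
    (measurable_pi_apply _)

theorem map_uniformOn_pair {M : Type*} [MeasurableSpace M] [MeasurableSingletonClass M] {a b : M}
    (hab : a ≠ b) {Ω : Type*} [MeasurableSpace Ω] {P : Measure Ω} {X : Ω → M} (hX : Measurable X)
    (h : P.map X = uniformOn {a, b}) :
    P.real (X ⁻¹' {a}) = 1 / 2 ∧ P.real (X ⁻¹' {b}) = 1 / 2 ∧ ∀ᵐ ω ∂P, X ω = a ∨ X ω = b := by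
  classical
  have hfin : ({a, b} : Set M).Finite := by simp
  have hcount : Measure.count ({a, b} : Set M) = 2 := by
    rw [Measure.count_apply_finite _ hfin]
    simp [hab]
  have hval : ∀ c ∈ ({a, b} : Set M), P.real (X ⁻¹' {c}) = 1 / 2 := by
    intro c hc
    rw [measureReal_def, ← Measure.map_apply hX (measurableSet_singleton c), h, uniformOn,
      cond_apply hfin.measurableSet, hcount, Set.inter_eq_right.2 (Set.singleton_subset_iff.2 hc),
      Measure.count_singleton]
    simp
  refine ⟨hval a (by simp), hval b (by simp), ?_⟩
  have hae : ∀ᵐ c ∂(P.map X), c ∈ ({a, b} : Set M) := by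
    rw [h, uniformOn]
    exact ae_cond_mem hfin.measurableSet
  exact ae_of_ae_map hX.aemeasurable hae

/-- Splitting on the value of the last step reproduces `walkMean_succ`; the induction needs all `F`
at once, since `F` is replaced by its right translates. -/
theorem integral_randomWalk {m : ℕ → ℕ} {Ω : Type*} [MeasurableSpace Ω] {P : Measure Ω}
    [IsProbabilityMeasure P] {R : ℕ → Ω → S m} (h : IsSimpleRandomWalk (gens m) P R) (n : ℕ)
    (F : S m → ℝ) :
    Integrable (fun ω => F (R n ω)) P ∧
      ∫ ω, F (R n ω) ∂P = walkMean (· * PresentedMonoid.of (Rel m) Letter.x)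
        (· * PresentedMonoid.of (Rel m) Letter.y) 1 n F := by
  classical
  obtain ⟨X, hX, hind, hlaw, h0, hR⟩ := h
  induction n generalizing F with
  | zero => simp [h0, walkMean]
  | succ n ih =>
    obtain ⟨hx, hy, hae⟩ := map_uniformOn_pair (of_x_ne_of_y m) (hX n) (hlaw n)
    have hindep := indepFun_randomWalk hX hind h0 hR n
    have hterm : ∀ g : S m, P.real (X n ⁻¹' {g}) = 1 / 2 →
        Integrable (fun ω => F (R n ω * g) * if X n ω = g then 1 else 0) P ∧
        ∫ ω, F (R n ω * g) * (if X n ω = g then 1 else 0) ∂P =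
          (∫ ω, F (R n ω * g) ∂P) * (1 / 2) := by
      intro g hg
      have hset : MeasurableSet (X n ⁻¹' {g}) := hX n (measurableSet_singleton g)
      have hind_eq : (fun ω => if X n ω = g then (1 : ℝ) else 0) =
          (X n ⁻¹' {g}).indicator 1 := by
        funext ω
        simp [Set.indicator_apply]
      have hint : Integrable (fun ω => if X n ω = g then (1 : ℝ) else 0) P := by
        rw [hind_eq]
        exact (integrable_const (1 : ℝ)).indicator hset
      have hi : IndepFun (fun ω => F (R n ω * g)) (fun ω => if X n ω = g then (1 : ℝ) else 0) P :=
        hindep.comp (φ := fun a => F (a * g)) (ψ := fun a => if a = g then (1 : ℝ) else 0)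
          (Measurable.of_discrete) (Measurable.of_discrete)
      have hF := (ih fun a => F (a * g)).1
      refine ⟨hi.integrable_mul hF hint, ?_⟩
      refine (hi.integral_mul_eq_mul_integral hF.aestronglyMeasurable
        hint.aestronglyMeasurable).trans ?_
      rw [hind_eq, integral_indicator_one hset, hg]
    obtain ⟨hx1, hx2⟩ := hterm _ hx
    obtain ⟨hy1, hy2⟩ := hterm _ hy
    have heq : (fun ω => F (R (n + 1) ω)) =ᵐ[P] fun ω =>
        F (R n ω * PresentedMonoid.of (Rel m) Letter.x) *
          (if X n ω = PresentedMonoid.of (Rel m) Letter.x then 1 else 0) +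
        F (R n ω * PresentedMonoid.of (Rel m) Letter.y) *
          (if X n ω = PresentedMonoid.of (Rel m) Letter.y then 1 else 0) := by
      filter_upwards [hae] with ω hω
      rw [hR]
      rcases hω with hω | hω
      · simp [hω, of_x_ne_of_y m]
      · simp [hω, (of_x_ne_of_y m).symm]
    refine ⟨(hx1.add hy1).congr heq.symm, ?_⟩
    rw [integral_congr_ae heq, integral_add hx1 hy1, hx2, hy2,
      (ih fun a => F (a * PresentedMonoid.of (Rel m) Letter.x)).2,
      (ih fun a => F (a * PresentedMonoid.of (Rel m) Letter.y)).2, walkMean_succ]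
    ring

theorem integral_wordLength {m : ℕ → ℕ} {Ω : Type*} [MeasurableSpace Ω] {P : Measure Ω}
    [IsProbabilityMeasure P] {R : ℕ → Ω → S m} (h : IsSimpleRandomWalk (gens m) P R) (n : ℕ) :
    Integrable (fun ω => (wordLength (gens m) (R n ω) : ℝ)) P ∧
      ∫ ω, (wordLength (gens m) (R n ω) : ℝ) ∂P = stateMean m n fun σ => (σ.length : ℝ) := by
  obtain ⟨h1, h2⟩ := integral_randomWalk h n fun a => (wordLength (gens m) a : ℝ)
  refine ⟨h1, h2.trans ?_⟩
  simp only [wordLength_eq]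
  exact walkMean_comp _ _ _ _ _ _ state (fun u => state_mul_of u Letter.x)
    (fun u => state_mul_of u Letter.y) (state_one m) n fun σ => (σ.length : ℝ)

end SemigroupSpeed

theorem mainTheorem8 (β δ : ℝ) (hβ : 1 ≤ β) (hδ : 0 < δ) :
    ∃ C₁ C₂ : ℝ, 0 < C₁ ∧ 0 < C₂ ∧
      ∀ m : ℕ → ℕ, StrictMono m → m 0 = 1 →
        (∀ i : ℕ, (m (i + 1) : ℝ) ≤ β * (m i : ℝ) + δ) →
        ∀ (Ω : Type*) [MeasurableSpace Ω] (P : Measure Ω) [IsProbabilityMeasure P]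
          (R : ℕ → Ω → SemigroupSpeed.S m),
          SemigroupSpeed.IsSimpleRandomWalk (SemigroupSpeed.gens m) P R →
          ∀ n : ℕ, 2 ≤ n →
            Integrable
              (fun ω => (SemigroupSpeed.wordLength (SemigroupSpeed.gens m) (R n ω) : ℝ)) P ∧
            C₁ * SemigroupSpeed.gamma m n ≤
              ∫ ω, (SemigroupSpeed.wordLength (SemigroupSpeed.gens m) (R n ω) : ℝ) ∂P ∧
            ∫ ω, (SemigroupSpeed.wordLength (SemigroupSpeed.gens m) (R n ω) : ℝ) ∂P ≤
              C₂ * (SemigroupSpeed.gamma m n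
                + (n : ℝ) ^ ((β - 1) / β) * Real.logb 2 n) := by
  refine ⟨1 / 32, 3 + 3 * (2 : ℝ) ^ (δ / β), by norm_num, by positivity, ?_⟩
  intro m hm h0 hgrowth Ω _ P _ R hR n hn
  obtain ⟨h1, h2⟩ := SemigroupSpeed.integral_wordLength hR n
  rw [h2]
  exact ⟨h1, SemigroupSpeed.gamma_le_stateMean_length hm h0 (by omega),
    SemigroupSpeed.stateMean_length_le_gamma hβ hm h0 hgrowth hn⟩
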